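/- Write $\mathbb F_4=\{0,1,\omega,\omega^2\}$. For $x=(x_1,\dots,x_n)\in\mathbb F_4^n$ let $\mathrm{wt}(x)$ be its Hamming weight and let $E_x=e_1\otimes\cdots\otimes e_n$ be the operator on $\mathbb C^{2^n}=(\mathbb C^2)^{\otimes n}$ with $e_j=I_2,\sigma_x,\sigma_z,\sigma_y$ according as $x_j=0,1,\omega,\omega^2$. For $0\le p\le 1$ the quantum symmetric depolarizing channel with error probability $p$ is $$\mathcal M(\rho)=\sum_{x\in\mathbb F_4^n}\Big(\frac p3\Big)^{\mathrm{wt}(x)}(1-p)^{n-\mathrm{wt}(x)}E_x\rho E_x^\dagger .$$ For an additive code $C\subseteq\mathbb F_4^n$ let $C^\perp=\{c:\mathrm{Tr}^{\mathbb F_4}_{\mathbb F_2}\sum_i c_i\overline{c_i'}=0\text{ for all }c'\in C\}$, where $\overline a=a^2$. A stabilizer code of length $n$ is a nonzero joint eigenspace $Q\subseteq\mathbb C^{2^n}$ of the operators $E_s$, $s\in C^\perp$, for some additive code $C\subseteq\mathbb F_4^n$ with $C^\perp\subseteq C$. Its fidelity on the channel is $$F(Q)=\sup_{\mathcal R}\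 \min_{|\psi\rangle\in Q,\ \|\psi\|=1}\langle\psi|\mathcal R(\mathcal M(|\psi\rangle\langle\psi|))|\psi\rangle ,$$ the supremum being over all trace-preserving completely positive linear maps $\mathcal R$ (recovery operators). With $P$ the orthogonal projector on $Q$, its quantum enumerators are, for $0\le j\le n$, $$B_j^\perp=\frac1{(\dim Q)^2}\sum_{\mathrm{wt}(x)=j}\big(\mathrm{Tr}(E_xP)\big)^2,\qquad B_j=\frac1{\dim Q}\sum_{\mathrm{wt}(x)=j}\mathrm{Tr}(E_xPE_xP).$$ Theorem. Let $Q$ be a stabilizer code of length $n$ with quantum enumerators $B_j^\perp$ and $B_j$, and let $0\le p\le 1$. Then $$1-F(Q)\le\sum_{m=1}^n\Big(\frac p3\Big)^m(1-p)^{n-m}\min\Big\{\binom nm3^m,\;N(m)\Big\},$$ where $$N(m)=\sum_{w=1}^{\min(2m,n)}(B_w-B_w^\perp)\,G(m,w),\qquad G(m,w)=\sum_{t=0}^{m}\binom wt2^t\sum_{h=\lceil (w-t)/2\rceil}^{m-t}\binom{w-t}{h}\binom{n-w}{m-t-h}3^{m-t-h}$$ (terms with $t>w$ are zero). -/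

import Mathlib

open scoped Matrix ComplexOrder

noncomputable section

namespace QCode

/-- The field with four elements. -/
abbrev F4 : Type := GaloisField 2 2

instance : Fintype F4 := Fintype.ofFinite F4

instance : DecidableEq F4 := Classical.decEq F4

/-- Basis labels of `n` qubits. -/
abbrev Idx (n : ℕ) : Type := Fin n → Fin 2

/-- The state space `(ℂ²)^{⊗ n} = ℂ^{2^n}` of `n` qubits, in the computational (product) basis. -/
abbrev Qubits (n : ℕ) : Type := EuclideanSpace ℂ (Idx n)

/-- Operators on the state space of `n` qubits. -/
abbrev Op (n : ℕ) : Type := Matrix (Idx n) (Idx n) ℂ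

def sigmaX : Matrix (Fin 2) (Fin 2) ℂ := !![0, 1; 1, 0]

def sigmaZ : Matrix (Fin 2) (Fin 2) ℂ := !![1, 0; 0, -1]

def sigmaY : Matrix (Fin 2) (Fin 2) ℂ := !![0, Complex.I; -Complex.I, 0]

/-- The one-qubit operator attached to an element of `F4 = {0, 1, ω, ω²}`. -/
def pauli (ω a : F4) : Matrix (Fin 2) (Fin 2) ℂ :=
  if a = 0 then 1 else if a = 1 then sigmaX else if a = ω then sigmaZ else sigmaY

/-- The error operator `E_x = e_1 ⊗ ⋯ ⊗ e_n`, in the product basis. -/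
def errorOp (ω : F4) {n : ℕ} (x : Fin n → F4) : Op n :=
  Matrix.of fun a b => ∏ i, pauli ω (x i) (a i) (b i)

/-- The probability `(p/3)^{wt x} (1-p)^{n - wt x}` of the error operator `E_x`. -/
def errorProb (p : ℝ) {n : ℕ} (x : Fin n → F4) : ℝ :=
  (p / 3) ^ hammingNorm x * (1 - p) ^ (n - hammingNorm x)

/-- The quantum symmetric depolarizing channel on `n` qubits with error probability `p`. -/
def depolarizing (ω : F4) (p : ℝ) {n : ℕ} (ρ : Op n) : Op n :=
  ∑ x : Fin n → F4, (errorProb p x : ℂ) • (errorOp ω x * ρ * (errorOp ω x)ᴴ)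

/-- Complete positivity: for every `k`, the map `id_k ⊗ R`, acting blockwise on `k × k` block
matrices, preserves positive semidefiniteness. -/
def IsCompletelyPositive {n : ℕ} (R : Op n →ₗ[ℂ] Op n) : Prop :=
  ∀ (k : ℕ) (A : Matrix (Fin k × Idx n) (Fin k × Idx n) ℂ), A.PosSemidef →
    (Matrix.of fun r s : Fin k × Idx n =>
      R (Matrix.of fun a b => A (r.1, a) (s.1, b)) r.2 s.2).PosSemidef

/-- A recovery operator: a trace-preserving completely positive linear map. -/
structure IsRecovery {n : ℕ} (R : Op n →ₗ[ℂ] Op n) : Prop where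
  completelyPositive : IsCompletelyPositive R
  tracePreserving : ∀ ρ : Op n, (R ρ).trace = ρ.trace

/-- `|ψ⟩⟨ψ|`. -/
def pureState {n : ℕ} (ψ : Qubits n) : Op n :=
  Matrix.vecMulVec (WithLp.ofLp ψ) (star (WithLp.ofLp ψ))

/-- `⟨ψ| A |ψ⟩`, a real number for the positive semidefinite `A` to which it is applied. -/
def expectation {n : ℕ} (A : Op n) (ψ : Qubits n) : ℝ :=
  (star (WithLp.ofLp ψ) ⬝ᵥ (A *ᵥ WithLp.ofLp ψ)).re

/-- The minimum fidelity `F(Q, M, R) = min_{|ψ⟩ ∈ Q} ⟨ψ| R(M(|ψ⟩⟨ψ|)) |ψ⟩` over the unit vectors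
of `Q`, for the depolarizing channel `M`. -/
def minFidelity (ω : F4) (p : ℝ) {n : ℕ} (Q : Submodule ℂ (Qubits n))
    (R : Op n →ₗ[ℂ] Op n) : ℝ :=
  ⨅ ψ : {ψ : Qubits n // ψ ∈ Q ∧ ‖ψ‖ = 1},
    expectation (R (depolarizing ω p (pureState ψ.1))) ψ.1

/-- The fidelity `F(Q)`: the best minimum fidelity over all recovery operators (all the
fidelities lie in `[0, 1]`). -/
def fidelity (ω : F4) (p : ℝ) {n : ℕ} (Q : Submodule ℂ (Qubits n)) : ℝ :=
  ⨆ R : {R : Op n →ₗ[ℂ] Op n // IsRecovery R}, minFidelity ω p Q R.1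

/-- The trace inner product `Tr (∑ i, c_i * conj c'_i)`; conjugation on `F4` is squaring. -/
def traceInner {n : ℕ} (c c' : Fin n → F4) : ZMod 2 :=
  Algebra.trace (ZMod 2) F4 (∑ i, c i * c' i ^ 2)

/-- The Hermitian dual of an additive code. -/
def hermitianDual {n : ℕ} (C : AddSubgroup (Fin n → F4)) : AddSubgroup (Fin n → F4) where
  carrier := {c | ∀ c' ∈ C, traceInner c c' = 0}
  zero_mem' := by
    intro c' _
    simp [traceInner]
  add_mem' := by
    intro a b ha hb c' hc'
    have h1 := ha c' hc'
    have h2 := hb c' hc'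
    simp only [traceInner] at h1 h2 ⊢
    simp only [Pi.add_apply, add_mul, Finset.sum_add_distrib, map_add, h1, h2, add_zero]
  neg_mem' := by
    intro a ha c' hc'
    have h1 := ha c' hc'
    simp only [traceInner] at h1 ⊢
    simp only [Pi.neg_apply, neg_mul, Finset.sum_neg_distrib, map_neg, h1, neg_zero]

/-- `Q` is a stabilizer code of length `n`: there is an additive code `C` over `F4` with
`C^⊥ ⊆ C` such that `Q` is a nonzero joint eigenspace of the error operators `E_s`, `s ∈ C^⊥`
(`ε s` being the eigenvalue of `E_s`). -/
def IsStabilizerCode (ω : F4) {n : ℕ} (Q : Submodule ℂ (Qubits n)) : Prop :=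
  ∃ C : AddSubgroup (Fin n → F4), hermitianDual C ≤ C ∧
    Q ≠ ⊥ ∧
    ∃ ε : (Fin n → F4) → ℂ, ∀ ψ : Qubits n,
      ψ ∈ Q ↔ ∀ s ∈ hermitianDual C,
        errorOp ω s *ᵥ WithLp.ofLp ψ = ε s • WithLp.ofLp ψ

/-- The matrix of the orthogonal projector on `Q`. -/
def projector {n : ℕ} (Q : Submodule ℂ (Qubits n)) : Op n :=
  Matrix.toEuclideanLin.symm (Q.starProjection : Qubits n →ₗ[ℂ] Qubits n)

/-- The quantum enumerator `B_j^⊥(Q)`; the traces are real, all the operators being Hermitian. -/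
def enumBperp (ω : F4) {n : ℕ} (Q : Submodule ℂ (Qubits n)) (j : ℕ) : ℝ :=
  1 / (Module.finrank ℂ Q : ℝ) ^ 2 *
    ∑ x : Fin n → F4 with hammingNorm x = j, ((errorOp ω x * projector Q).trace ^ 2).re

/-- The quantum enumerator `B_j(Q)`. -/
def enumB (ω : F4) {n : ℕ} (Q : Submodule ℂ (Qubits n)) (j : ℕ) : ℝ :=
  1 / (Module.finrank ℂ Q : ℝ) *
    ∑ x : Fin n → F4 with hammingNorm x = j,
      (errorOp ω x * projector Q * errorOp ω x * projector Q).trace.re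

/-- `G(m, w)`. For `t ≤ w` the lower limit `(w - t + 1) / 2` of the inner sum is `⌈(w - t) / 2⌉`;
the terms with `t > w` vanish. -/
def G (n m w : ℕ) : ℕ :=
  ∑ t ∈ Finset.range (m + 1), w.choose t * 2 ^ t *
    ∑ h ∈ Finset.Icc ((w - t + 1) / 2) (m - t),
      (w - t).choose h * (n - w).choose (m - t - h) * 3 ^ (m - t - h)

/-- `N(m)`. -/
def N (ω : F4) {n : ℕ} (Q : Submodule ℂ (Qubits n)) (m : ℕ) : ℝ :=
  ∑ w ∈ Finset.Icc 1 (min (2 * m) n), (enumB ω Q w - enumBperp ω Q w) * (G n m w : ℝ)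

end QCode

end

/-! Let `S` be the self-orthogonal additive code whose error operators have `Q` as a joint
eigenspace, with eigenvalues `ε s = ±1`, and let `S'` be its dual, which contains `S`. The error
operators multiply like the words of `F4ⁿ` up to phases of modulus one, and commute or anticommute
according to the trace form. Hence the projector onto `Q` is the average of the `ε(s) E_s`
(`IsJointEigenspace.projector_eq`), and computing traces shows that `B_w^⊥` and `B_w` count the
words of weight `w` in `S` and in `S'` (`enumBperp_eq`, `enumB_eq`): an error in `S'` preserves `Q`,
one outside `S'` maps `Q` to an orthogonal subspace.

The recovery operator measures the coset of the error modulo `S'` and undoes the error `r` of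
least weight in that coset. That this preserves the trace is the fact that the projectors onto the
translates of `Q` add up to the identity; their sum is a scalar by the orthogonality of characters,
and the scalar is found by multiplying by the projector (`sum_errorOp_conj_projector`). To avoid
choosing one word from each coset, the recovery operator is written as an average over all words.
It restores every state of `Q` when the error `x` satisfies `x - r ∈ S`, and the other
terms contribute nonnegatively, so `1 - F(Q)` is at most the probability of the words with
`x - r ∉ S` (`sum_errorProb_le_fidelity`).

If such an `x` has weight `m`, then `c = x - r` lies in `S' \ S`, has weight at most `2m`, and `x`
is at distance `wt r ≤ m` from `c`. There are `B_w - B_w^⊥` words `c` of weight `w`, and for each of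
them at most `G(m, w)` words `x` (`card_le_G`), which gives the bound `N(m)`
(`card_uncorrected_le`). The other bound is the number of all words of weight `m`. -/

noncomputable section

namespace QCode

/-! ### The field with four elements and its trace form -/

theorem F4.add_self (a : F4) : a + a = 0 := CharTwo.add_self_eq_zero a

theorem F4.card : Nat.card F4 = 4 := by
  have := GaloisField.card 2 2 (by norm_num)
  simpa using this

theorem F4.fintype_card : Fintype.card F4 = 4 := by
  rw [← Nat.card_eq_fintype_card, F4.card]

theorem F4.pow_four (a : F4) : a ^ 4 = a := by
  have h := FiniteField.pow_card a
  rwa [F4.fintype_card] at h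

theorem F4.cases {ω : F4} (hω : ω ^ 2 + ω + 1 = 0) (a : F4) :
    a = 0 ∨ a = 1 ∨ a = ω ∨ a = ω + 1 := by
  have h4 := F4.pow_four a
  have h2 : (2 : F4) = 0 := CharTwo.two_eq_zero
  have h : a * ((a - 1) * ((a - ω) * (a - (ω + 1)))) = 0 := by
    linear_combination h4 + (a ^ 2 - a) * hω + (-a ^ 3 * ω - a ^ 3 + a ^ 2 * ω + a) * h2
  simpa [mul_eq_zero, sub_eq_zero] using h

theorem F4.algebraMap_trace (a : F4) :
    algebraMap (ZMod 2) F4 (Algebra.trace (ZMod 2) F4 a) = a + a ^ 2 := by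
  rw [FiniteField.algebraMap_trace_eq_sum_pow, GaloisField.finrank 2 (by norm_num)]
  simp [Finset.sum_range_succ]

theorem F4.trace_eq_zero_iff (a : F4) :
    Algebra.trace (ZMod 2) F4 a = 0 ↔ a + a ^ 2 = 0 := by
  rw [← F4.algebraMap_trace]
  exact (map_eq_zero (algebraMap (ZMod 2) F4)).symm

theorem F4.trace_mul_sq_comm (a b : F4) :
    Algebra.trace (ZMod 2) F4 (a * b ^ 2) = Algebra.trace (ZMod 2) F4 (b * a ^ 2) := by
  apply (algebraMap (ZMod 2) F4).injective
  rw [F4.algebraMap_trace, F4.algebraMap_trace]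
  linear_combination a ^ 2 * F4.pow_four b - b ^ 2 * F4.pow_four a

theorem traceInner_add_left {n : ℕ} (a b c : Fin n → F4) :
    traceInner (a + b) c = traceInner a c + traceInner b c := by
  simp [traceInner, add_mul, Finset.sum_add_distrib]

theorem traceInner_comm {n : ℕ} (a b : Fin n → F4) : traceInner a b = traceInner b a := by
  simp only [traceInner, map_sum, F4.trace_mul_sq_comm]

/-- The nontrivial additive character of `ZMod 2`, with values in `ℂ`. -/
def sgn (z : ZMod 2) : ℂ := if z = 0 then 1 else -1

theorem sgn_zero : sgn 0 = 1 := by simp [sgn]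

theorem sgn_add (a b : ZMod 2) : sgn (a + b) = sgn a * sgn b := by
  have h : ∀ a b : ZMod 2, a + b = 0 ↔ (a = 0 ↔ b = 0) := by decide
  simp only [sgn, h]
  by_cases ha : a = 0 <;> by_cases hb : b = 0 <;> simp [ha, hb]

theorem sgn_sum {ι : Type*} (s : Finset ι) (f : ι → ZMod 2) :
    sgn (∑ i ∈ s, f i) = ∏ i ∈ s, sgn (f i) := by
  classical
  induction s using Finset.induction_on with
  | empty => simp [sgn_zero]
  | insert a s ha ih => rw [Finset.sum_insert ha, Finset.prod_insert ha, sgn_add, ih]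

/-! ### Tensor products of one-qubit operators -/

/-- The tensor product `f 1 ⊗ ⋯ ⊗ f n`, in the product basis. -/
def tensor {n : ℕ} (f : Fin n → Matrix (Fin 2) (Fin 2) ℂ) : Op n :=
  Matrix.of fun a b => ∏ i, f i (a i) (b i)

theorem errorOp_eq_tensor (ω : F4) {n : ℕ} (x : Fin n → F4) :
    errorOp ω x = tensor fun i => pauli ω (x i) := rfl

theorem tensor_mul {n : ℕ} (f g : Fin n → Matrix (Fin 2) (Fin 2) ℂ) :
    tensor f * tensor g = tensor fun i => f i * g i := by
  ext a b
  simp only [tensor, Matrix.mul_apply, Matrix.of_apply, Fintype.prod_sum, Finset.prod_mul_distrib]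

theorem tensor_smul {n : ℕ} (c : Fin n → ℂ) (f : Fin n → Matrix (Fin 2) (Fin 2) ℂ) :
    (tensor fun i => c i • f i) = (∏ i, c i) • tensor f := by
  ext a b
  simp [tensor, Finset.prod_mul_distrib]

theorem trace_tensor {n : ℕ} (f : Fin n → Matrix (Fin 2) (Fin 2) ℂ) :
    (tensor f).trace = ∏ i, (f i).trace := by
  simp only [tensor, Matrix.trace, Matrix.diag, Matrix.of_apply, Fintype.prod_sum]

theorem tensor_one {n : ℕ} : tensor (fun _ : Fin n => 1) = 1 := by
  ext a b
  by_cases h : a = b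
  · subst h; simp [tensor]
  · obtain ⟨i, hi⟩ := Function.ne_iff.1 h
    rw [Matrix.one_apply_ne h]
    exact Finset.prod_eq_zero (Finset.mem_univ i) (Matrix.one_apply_ne hi)

theorem conjTranspose_tensor {n : ℕ} (f : Fin n → Matrix (Fin 2) (Fin 2) ℂ) :
    (tensor f)ᴴ = tensor fun i => (f i)ᴴ := by
  ext a b
  simp [tensor, Matrix.conjTranspose_apply]

/-! ### The error operators -/

theorem ne_zero_of_omega {ω : F4} (hω : ω ^ 2 + ω + 1 = 0) : ω ≠ 0 := by
  rintro rfl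
  simp at hω

theorem ne_one_of_omega {ω : F4} (hω : ω ^ 2 + ω + 1 = 0) : ω ≠ 1 := by
  rintro rfl
  rw [one_pow, F4.add_self, zero_add] at hω
  exact one_ne_zero hω

theorem omega_add_one_ne_zero {ω : F4} (hω : ω ^ 2 + ω + 1 = 0) : ω + 1 ≠ 0 := by
  intro h
  rw [add_assoc, h, add_zero] at hω
  simp [pow_eq_zero_iff two_ne_zero |>.1 hω] at h

theorem pauli_zero (ω : F4) : pauli ω 0 = 1 := if_pos rfl

theorem pauli_one (ω : F4) : pauli ω 1 = sigmaX := by simp [pauli]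

theorem pauli_omega {ω : F4} (hω : ω ^ 2 + ω + 1 = 0) : pauli ω ω = sigmaZ := by
  simp [pauli, ne_zero_of_omega hω, ne_one_of_omega hω]

theorem pauli_omega_add_one {ω : F4} (hω : ω ^ 2 + ω + 1 = 0) : pauli ω (ω + 1) = sigmaY := by
  simp [pauli, ne_zero_of_omega hω, omega_add_one_ne_zero hω]

theorem conjTranspose_pauli (ω a : F4) : (pauli ω a)ᴴ = pauli ω a := by
  unfold pauli
  split_ifs
  · simp
  all_goals
    ext i j
    fin_cases i <;> fin_cases j <;>
      simp [sigmaX, sigmaY, sigmaZ, Matrix.conjTranspose_apply]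

theorem pauli_mul_self (ω a : F4) : pauli ω a * pauli ω a = 1 := by
  unfold pauli
  split_ifs
  · simp
  all_goals
    ext i j
    fin_cases i <;> fin_cases j <;>
      simp [sigmaX, sigmaY, sigmaZ, Matrix.mul_apply, Fin.sum_univ_two]

theorem trace_pauli (ω a : F4) : (pauli ω a).trace = if a = 0 then 2 else 0 := by
  unfold pauli
  split_ifs <;> simp [sigmaX, sigmaY, sigmaZ, Matrix.trace, Fin.sum_univ_two]

theorem sigmaX_mul_sigmaZ : sigmaX * sigmaZ = Complex.I • sigmaY := by
  ext i j
  fin_cases i <;> fin_cases j <;> simp [sigmaX, sigmaY, sigmaZ, Matrix.mul_apply]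

theorem sigmaZ_mul_sigmaX : sigmaZ * sigmaX = -Complex.I • sigmaY := by
  ext i j
  fin_cases i <;> fin_cases j <;> simp [sigmaX, sigmaY, sigmaZ, Matrix.mul_apply]

theorem sigmaX_mul_sigmaY : sigmaX * sigmaY = -Complex.I • sigmaZ := by
  ext i j
  fin_cases i <;> fin_cases j <;> simp [sigmaX, sigmaY, sigmaZ, Matrix.mul_apply]

theorem sigmaY_mul_sigmaX : sigmaY * sigmaX = Complex.I • sigmaZ := by
  ext i j
  fin_cases i <;> fin_cases j <;> simp [sigmaX, sigmaY, sigmaZ, Matrix.mul_apply]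

theorem sigmaZ_mul_sigmaY : sigmaZ * sigmaY = Complex.I • sigmaX := by
  ext i j
  fin_cases i <;> fin_cases j <;> simp [sigmaX, sigmaY, sigmaZ, Matrix.mul_apply]

theorem sigmaY_mul_sigmaZ : sigmaY * sigmaZ = -Complex.I • sigmaX := by
  ext i j
  fin_cases i <;> fin_cases j <;> simp [sigmaX, sigmaY, sigmaZ, Matrix.mul_apply]

theorem exists_pauli_mul {ω : F4} (hω : ω ^ 2 + ω + 1 = 0) (a b : F4) :
    ∃ φ : ℂ, star φ * φ = 1 ∧ pauli ω a * pauli ω b = φ • pauli ω (a + b) := by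
  by_cases hab : a = b
  · subst hab
    exact ⟨1, by simp, by rw [pauli_mul_self, F4.add_self, pauli_zero, one_smul]⟩
  have e1 : (1 : F4) + (ω + 1) = ω := by linear_combination F4.add_self 1
  have e2 : ω + 1 + 1 = ω := by linear_combination F4.add_self 1
  have e3 : ω + (ω + 1) = 1 := by linear_combination F4.add_self ω
  have e4 : ω + 1 + ω = 1 := by linear_combination F4.add_self ω
  have hX := pauli_one ω
  have hZ := pauli_omega hω
  have hY := pauli_omega_add_one hω
  rcases F4.cases hω a with rfl | rfl | rfl | rfl
  · exact ⟨1, by simp, by simp [pauli_zero]⟩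
  all_goals rcases F4.cases hω b with rfl | rfl | rfl | rfl
  all_goals first
    | exact absurd rfl hab
    | exact ⟨1, by simp, by rw [pauli_zero, mul_one, add_zero, one_smul]⟩
    | skip
  · exact ⟨Complex.I, by simp, by rw [hX, hZ, add_comm, hY, sigmaX_mul_sigmaZ]⟩
  · exact ⟨-Complex.I, by simp, by rw [e1, hX, hZ, hY, sigmaX_mul_sigmaY]⟩
  · exact ⟨-Complex.I, by simp, by rw [hX, hZ, hY, sigmaZ_mul_sigmaX]⟩
  · exact ⟨Complex.I, by simp, by rw [e3, hX, hZ, hY, sigmaZ_mul_sigmaY]⟩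
  · exact ⟨Complex.I, by simp, by rw [e2, hX, hZ, hY, sigmaY_mul_sigmaX]⟩
  · exact ⟨-Complex.I, by simp, by rw [e4, hX, hZ, hY, sigmaY_mul_sigmaZ]⟩

/-- Two distinct nonzero elements of `F4` pair to `1` under the trace form. -/
theorem F4.trace_mul_sq_ne_zero {a b : F4} (ha : a ≠ 0) (hb : b ≠ 0) (hab : a ≠ b) :
    Algebra.trace (ZMod 2) F4 (a * b ^ 2) ≠ 0 := by
  rw [Ne, F4.trace_eq_zero_iff]
  intro h
  have h' : a * (b * (a - b)) = 0 := by
    linear_combination h - a ^ 2 * F4.pow_four b - F4.add_self (a * b ^ 2)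
  simp [ha, hb, sub_ne_zero.2 hab] at h'

/-- Two Pauli matrices commute or anticommute, according to the trace form. -/
theorem pauli_mul_comm {ω : F4} (hω : ω ^ 2 + ω + 1 = 0) (a b : F4) :
    pauli ω a * pauli ω b =
      sgn (Algebra.trace (ZMod 2) F4 (a * b ^ 2)) • (pauli ω b * pauli ω a) := by
  by_cases hab : a = b
  · subst hab
    have h : a * a ^ 2 + (a * a ^ 2) ^ 2 = 0 := by
      linear_combination a ^ 2 * F4.pow_four a + F4.add_self (a ^ 3)
    rw [(F4.trace_eq_zero_iff _).2 h, sgn_zero, one_smul]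
  by_cases ha : a = 0
  · simp [ha, sgn_zero, pauli_zero]
  by_cases hb : b = 0
  · simp [hb, sgn_zero, pauli_zero]
  rw [sgn, if_neg (F4.trace_mul_sq_ne_zero ha hb hab)]
  have hX := pauli_one ω
  have hZ := pauli_omega hω
  have hY := pauli_omega_add_one hω
  rcases F4.cases hω a with rfl | rfl | rfl | rfl
  · exact absurd rfl ha
  all_goals rcases F4.cases hω b with rfl | rfl | rfl | rfl
  all_goals first
    | exact absurd rfl hab
    | exact absurd rfl hb
    | simp [hX, hZ, hY, sigmaX_mul_sigmaZ, sigmaX_mul_sigmaY, sigmaZ_mul_sigmaX,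
        sigmaZ_mul_sigmaY, sigmaY_mul_sigmaX, sigmaY_mul_sigmaZ]

variable {n : ℕ}

theorem conjTranspose_errorOp (ω : F4) (x : Fin n → F4) : (errorOp ω x)ᴴ = errorOp ω x := by
  simp only [errorOp_eq_tensor, conjTranspose_tensor, conjTranspose_pauli]

theorem errorOp_mul_self (ω : F4) (x : Fin n → F4) : errorOp ω x * errorOp ω x = 1 := by
  simp only [errorOp_eq_tensor, tensor_mul, pauli_mul_self, tensor_one]

theorem errorOp_mul_cancel (ω : F4) (x : Fin n → F4) (A : Op n) :
    errorOp ω x * (errorOp ω x * A) = A := by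
  rw [← mul_assoc, errorOp_mul_self, one_mul]

theorem errorOp_zero (ω : F4) : errorOp ω (0 : Fin n → F4) = 1 := by
  simp only [errorOp_eq_tensor, Pi.zero_apply, pauli_zero, tensor_one]

theorem exists_errorOp_mul {ω : F4} (hω : ω ^ 2 + ω + 1 = 0) (x y : Fin n → F4) :
    ∃ φ : ℂ, star φ * φ = 1 ∧ errorOp ω x * errorOp ω y = φ • errorOp ω (x + y) := by
  choose φ h1 h2 using fun i => exists_pauli_mul hω (x i) (y i)
  refine ⟨∏ i, φ i, ?_, ?_⟩
  · rw [star_prod, ← Finset.prod_mul_distrib]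
    exact Finset.prod_eq_one fun i _ => h1 i
  · simp only [errorOp_eq_tensor, tensor_mul, h2, tensor_smul, Pi.add_apply]

theorem errorOp_mul_comm {ω : F4} (hω : ω ^ 2 + ω + 1 = 0) (x y : Fin n → F4) :
    errorOp ω x * errorOp ω y = sgn (traceInner x y) • (errorOp ω y * errorOp ω x) := by
  simp only [errorOp_eq_tensor, tensor_mul, traceInner, map_sum, sgn_sum, ← tensor_smul]
  congr 1
  funext i
  exact pauli_mul_comm hω _ _

theorem trace_errorOp (ω : F4) (x : Fin n → F4) :
    (errorOp ω x).trace = if x = 0 then 2 ^ n else 0 := by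
  rw [errorOp_eq_tensor, trace_tensor]
  split_ifs with h
  · simp [h, trace_pauli]
  · obtain ⟨i, hi⟩ := Function.ne_iff.1 h
    refine Finset.prod_eq_zero (Finset.mem_univ i) ?_
    rw [trace_pauli]
    exact if_neg hi

theorem add_eq_zero_iff_eq_of_F4 (x y : Fin n → F4) : x + y = 0 ↔ x = y := by
  constructor
  · intro h
    funext i
    have := congrFun h i
    simp only [Pi.add_apply, Pi.zero_apply] at this
    linear_combination this - F4.add_self (y i)
  · rintro rfl
    funext i
    exact F4.add_self _

theorem trace_errorOp_mul {ω : F4} (hω : ω ^ 2 + ω + 1 = 0) (x y : Fin n → F4) :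
    (errorOp ω x * errorOp ω y).trace = if x = y then 2 ^ n else 0 := by
  by_cases h : x = y
  · rw [if_pos h, h, errorOp_mul_self, ← errorOp_zero ω, trace_errorOp, if_pos rfl]
  · obtain ⟨φ, -, hφ⟩ := exists_errorOp_mul hω x y
    rw [hφ, Matrix.trace_smul, trace_errorOp, if_neg (mt (add_eq_zero_iff_eq_of_F4 x y).1 h),
      if_neg h, smul_zero]

/-! ### The twirl over all error operators -/

/-- The trace form is nondegenerate. -/
theorem exists_traceInner_ne_zero {s : Fin n → F4} (hs : s ≠ 0) :
    ∃ x : Fin n → F4, traceInner x s ≠ 0 := by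
  obtain ⟨i, hi⟩ := Function.ne_iff.1 hs
  obtain ⟨a, ha⟩ : ∃ a : F4, a ∉ ({0, s i} : Finset F4) := by
    by_contra! h
    have h1 := Finset.card_le_card (fun a _ => h a : Finset.univ ⊆ ({0, s i} : Finset F4))
    rw [Finset.card_univ, F4.fintype_card] at h1
    have := Finset.card_le_two (a := (0 : F4)) (b := s i)
    omega
  simp only [Finset.mem_insert, Finset.mem_singleton, not_or] at ha
  refine ⟨Pi.single i a, ?_⟩
  rw [traceInner, Finset.sum_eq_single i]
  · simpa using F4.trace_mul_sq_ne_zero ha.1 hi ha.2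
  · intro j _ hj
    simp [hj]
  · simp

theorem sum_sgn_traceInner {s : Fin n → F4} (hs : s ≠ 0) :
    ∑ x : Fin n → F4, sgn (traceInner x s) = 0 := by
  obtain ⟨y, hy⟩ := exists_traceInner_ne_zero hs
  have h : ∑ x : Fin n → F4, sgn (traceInner x s) =
      ∑ x : Fin n → F4, sgn (traceInner y s) * sgn (traceInner x s) := by
    rw [← Equiv.sum_comp (Equiv.addLeft y)]
    simp only [Equiv.coe_addLeft, traceInner_add_left, sgn_add]
  rw [← Finset.mul_sum, sgn, if_neg hy] at h
  linear_combination h / 2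

theorem errorOp_conj {ω : F4} (hω : ω ^ 2 + ω + 1 = 0) (x s : Fin n → F4) :
    errorOp ω x * errorOp ω s * errorOp ω x = sgn (traceInner x s) • errorOp ω s := by
  rw [errorOp_mul_comm hω, smul_mul_assoc, mul_assoc, errorOp_mul_self, mul_one]

theorem sum_errorOp_conj {ω : F4} (hω : ω ^ 2 + ω + 1 = 0) {s : Fin n → F4} (hs : s ≠ 0) :
    ∑ x : Fin n → F4, errorOp ω x * errorOp ω s * errorOp ω x = 0 := by
  simp only [errorOp_conj hω, ← Finset.sum_smul, sum_sgn_traceInner hs, zero_smul]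

/-! ### The projector onto a stabilizer code -/

/-- `Q` is the nonzero joint eigenspace of the error operators `E_s`, `s ∈ S`, with
eigenvalues `ε s`. -/
structure IsJointEigenspace (ω : F4) (S : AddSubgroup (Fin n → F4)) (ε : (Fin n → F4) → ℂ)
    (Q : Submodule ℂ (Qubits n)) : Prop where
  ne_bot : Q ≠ ⊥
  mem_iff : ∀ ψ : Qubits n,
    ψ ∈ Q ↔ ∀ s ∈ S, errorOp ω s *ᵥ WithLp.ofLp ψ = ε s • WithLp.ofLp ψ

open Classical in
/-- The average of the operators `ε(s) E_s` over `s ∈ S`; it is the projector onto the joint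
eigenspace with eigenvalues `ε`. -/
def stabProj (ω : F4) (S : AddSubgroup (Fin n → F4)) (ε : (Fin n → F4) → ℂ) : Op n :=
  (Nat.card S : ℂ)⁻¹ • ∑ s : S, ε s • errorOp ω (s : Fin n → F4)

theorem card_ne_zero (S : AddSubgroup (Fin n → F4)) : (Nat.card S : ℂ) ≠ 0 :=
  Nat.cast_ne_zero.2 Nat.card_pos.ne'

theorem mulVec_projector (Q : Submodule ℂ (Qubits n)) (v : Qubits n) :
    projector Q *ᵥ WithLp.ofLp v = WithLp.ofLp (Q.starProjection v) := by
  have h : Matrix.toEuclideanLin (projector Q) v = Q.starProjection v := by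
    rw [projector, LinearEquiv.apply_symm_apply]
    rfl
  rw [← h]
  rfl

theorem projector_mulVec {Q : Submodule ℂ (Qubits n)} {v : Qubits n} (hv : v ∈ Q) :
    projector Q *ᵥ WithLp.ofLp v = WithLp.ofLp v := by
  rw [mulVec_projector, Submodule.starProjection_eq_self_iff.2 hv]

theorem trace_projector (Q : Submodule ℂ (Qubits n)) :
    (projector Q).trace = (Module.finrank ℂ Q : ℂ) := by
  have hP : LinearMap.IsProj Q (Q.starProjection : Qubits n →ₗ[ℂ] Qubits n) :=
    ⟨fun v => by simp, fun v hv => by simpa using Submodule.starProjection_eq_self_iff.2 hv⟩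
  rw [← hP.trace, LinearMap.trace_eq_matrix_trace ℂ (EuclideanSpace.basisFun (Idx n) ℂ).toBasis,
    projector, Matrix.toEuclideanLin_eq_toLin_orthonormal]
  rfl

namespace IsJointEigenspace

variable {ω : F4} {S : AddSubgroup (Fin n → F4)} {ε : (Fin n → F4) → ℂ}
  {Q : Submodule ℂ (Qubits n)}

theorem exists_vec (h : IsJointEigenspace ω S ε Q) : ∃ v : Idx n → ℂ, v ≠ 0 ∧
    ∀ s ∈ S, errorOp ω s *ᵥ v = ε s • v := by
  obtain ⟨ψ, hψ, hne⟩ := Submodule.exists_mem_ne_zero_of_ne_bot h.ne_bot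
  exact ⟨WithLp.ofLp ψ, by simpa using hne, (h.mem_iff ψ).1 hψ⟩

theorem eigenvalue_mul_self (h : IsJointEigenspace ω S ε Q) {s : Fin n → F4} (hs : s ∈ S) :
    ε s * ε s = 1 := by
  obtain ⟨v, hv, hE⟩ := h.exists_vec
  have h1 : errorOp ω s *ᵥ (errorOp ω s *ᵥ v) = (ε s * ε s) • v := by
    rw [hE s hs, Matrix.mulVec_smul, hE s hs, smul_smul]
  rw [Matrix.mulVec_mulVec, errorOp_mul_self, Matrix.one_mulVec] at h1
  exact smul_left_injective ℂ hv (by simpa using h1.symm)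

theorem star_eigenvalue (h : IsJointEigenspace ω S ε Q) {s : Fin n → F4} (hs : s ∈ S) :
    star (ε s) = ε s := by
  rcases mul_self_eq_one_iff.1 (h.eigenvalue_mul_self hs) with h | h <;> simp [h]

theorem eigenvalue_zero (h : IsJointEigenspace ω S ε Q) : ε 0 = 1 := by
  obtain ⟨v, hv, hE⟩ := h.exists_vec
  have h1 := hE 0 S.zero_mem
  rw [errorOp_zero, Matrix.one_mulVec] at h1
  exact smul_left_injective ℂ hv (by simpa using h1.symm)

/-- The operators `ε(s) E_s` form a group. -/
theorem errorOp_mul_smul (hω : ω ^ 2 + ω + 1 = 0) (h : IsJointEigenspace ω S ε Q)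
    {s t : Fin n → F4} (hs : s ∈ S) (ht : t ∈ S) :
    errorOp ω t * (ε s • errorOp ω s) = ε t • (ε (t + s) • errorOp ω (t + s)) := by
  obtain ⟨v, hv, hE⟩ := h.exists_vec
  obtain ⟨φ, -, hφ⟩ := exists_errorOp_mul hω t s
  have h1 : (ε s * ε t) • v = (φ * ε (t + s)) • v := by
    have h2 : errorOp ω t *ᵥ (errorOp ω s *ᵥ v) = (ε s * ε t) • v := by
      rw [hE s hs, Matrix.mulVec_smul, hE t ht, smul_smul]
    rw [← h2, Matrix.mulVec_mulVec, hφ, Matrix.smul_mulVec, hE _ (S.add_mem ht hs), smul_smul]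
  have h3 : ε s * ε t = φ * ε (t + s) := smul_left_injective ℂ hv h1
  rw [Matrix.mul_smul, hφ, smul_smul, smul_smul]
  congr 1
  have hs1 := h.eigenvalue_mul_self hs
  have ht1 := h.eigenvalue_mul_self ht
  have hst := h.eigenvalue_mul_self (S.add_mem ht hs)
  linear_combination (- ε s * φ) * hst + ε s * ε (t + s) * (- h3) + ε t * ε (t + s) * hs1

theorem errorOp_mul_stabProj (hω : ω ^ 2 + ω + 1 = 0) (h : IsJointEigenspace ω S ε Q)
    {t : Fin n → F4} (ht : t ∈ S) :
    errorOp ω t * stabProj ω S ε = ε t • stabProj ω S ε := by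
  classical
  rw [stabProj, Matrix.mul_smul, Finset.mul_sum, smul_comm (ε t), Finset.smul_sum (r := ε t)]
  congr 1
  rw [← Equiv.sum_comp (Equiv.addLeft (⟨t, ht⟩ : S))
    (fun s : S => ε t • ε s • errorOp ω (s : Fin n → F4))]
  refine Finset.sum_congr rfl fun s _ => ?_
  rw [h.errorOp_mul_smul hω s.2 ht]
  rfl

theorem conjTranspose_stabProj (h : IsJointEigenspace ω S ε Q) :
    (stabProj ω S ε)ᴴ = stabProj ω S ε := by
  classical
  simp only [stabProj, Matrix.conjTranspose_smul, Matrix.conjTranspose_sum,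
    conjTranspose_errorOp]
  congr 1
  · simp
  · exact Finset.sum_congr rfl fun s _ => by rw [h.star_eigenvalue s.2]

theorem stabProj_mul_errorOp (hω : ω ^ 2 + ω + 1 = 0) (h : IsJointEigenspace ω S ε Q)
    {t : Fin n → F4} (ht : t ∈ S) :
    stabProj ω S ε * errorOp ω t = ε t • stabProj ω S ε := by
  have h1 := congrArg Matrix.conjTranspose (h.errorOp_mul_stabProj hω ht)
  rwa [Matrix.conjTranspose_mul, Matrix.conjTranspose_smul, h.conjTranspose_stabProj,
    conjTranspose_errorOp, h.star_eigenvalue ht] at h1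

theorem stabProj_mulVec (h : IsJointEigenspace ω S ε Q) {v : Qubits n} (hv : v ∈ Q) :
    stabProj ω S ε *ᵥ WithLp.ofLp v = WithLp.ofLp v := by
  classical
  rw [stabProj, Matrix.smul_mulVec, Matrix.sum_mulVec,
    Finset.sum_congr rfl (g := fun _ : S => WithLp.ofLp v)]
  · rw [Finset.sum_const, Finset.card_univ, ← Nat.card_eq_fintype_card, ← Nat.cast_smul_eq_nsmul ℂ,
      inv_smul_smul₀ (card_ne_zero S)]
  · intro s _
    rw [Matrix.smul_mulVec, (h.mem_iff v).1 hv s s.2, smul_smul, h.eigenvalue_mul_self s.2,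
      one_smul]

theorem projector_eq (hω : ω ^ 2 + ω + 1 = 0) (h : IsJointEigenspace ω S ε Q) :
    projector Q = stabProj ω S ε := by
  apply Matrix.toEuclideanLin.injective
  ext1 v
  rw [projector, LinearEquiv.apply_symm_apply]
  refine Submodule.eq_starProjection_of_mem_of_inner_eq_zero ?_ ?_
  · rw [h.mem_iff]
    intro s hs
    change _ *ᵥ (_ *ᵥ _) = _ • (_ *ᵥ _)
    rw [Matrix.mulVec_mulVec, h.errorOp_mul_stabProj hω hs,
      Matrix.smul_mulVec]
  · intro w hw
    have hsymm : (Matrix.toEuclideanLin (stabProj ω S ε)).IsSymmetric :=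
      Matrix.isSymmetric_toEuclideanLin_iff.2 h.conjTranspose_stabProj
    have hw' : Matrix.toEuclideanLin (stabProj ω S ε) w = w := by
      rw [Matrix.toLpLin_apply, h.stabProj_mulVec hw]
    rw [inner_sub_left, hsymm v w, hw', sub_self]

theorem conjTranspose_projector (hω : ω ^ 2 + ω + 1 = 0) (h : IsJointEigenspace ω S ε Q) :
    (projector Q)ᴴ = projector Q := by
  rw [h.projector_eq hω, h.conjTranspose_stabProj]

theorem projector_mul_self (hω : ω ^ 2 + ω + 1 = 0) (h : IsJointEigenspace ω S ε Q) :
    projector Q * projector Q = projector Q := by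
  classical
  nth_rw 1 [h.projector_eq hω]
  rw [h.projector_eq hω]
  nth_rw 1 [stabProj]
  rw [smul_mul_assoc, Finset.sum_mul, Finset.sum_congr rfl (g := fun _ : S => stabProj ω S ε)]
  · rw [Finset.sum_const, Finset.card_univ, ← Nat.card_eq_fintype_card, ← Nat.cast_smul_eq_nsmul ℂ,
      inv_smul_smul₀ (card_ne_zero S)]
  · intro s _
    rw [smul_mul_assoc, h.errorOp_mul_stabProj hω s.2, smul_smul, h.eigenvalue_mul_self s.2,
      one_smul]

theorem trace_errorOp_mul_projector (hω : ω ^ 2 + ω + 1 = 0) (h : IsJointEigenspace ω S ε Q)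
    (x : Fin n → F4) : (errorOp ω x * projector Q).trace =
      open Classical in if x ∈ S then ε x * ((Nat.card S : ℂ)⁻¹ * 2 ^ n) else 0 := by
  classical
  rw [h.projector_eq hω, stabProj, Matrix.mul_smul, Finset.mul_sum, Matrix.trace_smul,
    Matrix.trace_sum]
  simp only [Matrix.mul_smul, Matrix.trace_smul, trace_errorOp_mul hω]
  split_ifs with hx
  · rw [Finset.sum_eq_single ⟨x, hx⟩]
    · simp only [if_true, smul_eq_mul]
      ring
    · intro s _ hs
      rw [if_neg (fun e => hs (Subtype.ext e.symm)), smul_zero]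
    · simp
  · rw [Finset.sum_eq_zero, smul_zero]
    intro s _
    rw [if_neg (fun e : x = s => hx (e ▸ s.2)), smul_zero]

theorem finrank_eq (hω : ω ^ 2 + ω + 1 = 0) (h : IsJointEigenspace ω S ε Q) :
    (Module.finrank ℂ Q : ℂ) = (Nat.card S : ℂ)⁻¹ * 2 ^ n := by
  have h1 := h.trace_errorOp_mul_projector hω 0
  rwa [errorOp_zero, one_mul, trace_projector, if_pos S.zero_mem, h.eigenvalue_zero, one_mul] at h1

theorem finrank_ne_zero (h : IsJointEigenspace ω S ε Q) : (Module.finrank ℂ Q : ℝ) ≠ 0 :=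
  Nat.cast_ne_zero.2 (mt Submodule.finrank_eq_zero.1 h.ne_bot)

theorem projector_ne_zero (h : IsJointEigenspace ω S ε Q) : projector Q ≠ 0 := by
  intro h0
  have h1 := trace_projector Q
  rw [h0, Matrix.trace_zero] at h1
  exact h.finrank_ne_zero (by exact_mod_cast h1.symm)

theorem errorOp_mul_projector (hω : ω ^ 2 + ω + 1 = 0) (h : IsJointEigenspace ω S ε Q)
    {t : Fin n → F4} (ht : t ∈ S) : errorOp ω t * projector Q = ε t • projector Q := by
  rw [h.projector_eq hω, h.errorOp_mul_stabProj hω ht]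

theorem projector_mul_errorOp (hω : ω ^ 2 + ω + 1 = 0) (h : IsJointEigenspace ω S ε Q)
    {t : Fin n → F4} (ht : t ∈ S) : projector Q * errorOp ω t = ε t • projector Q := by
  rw [h.projector_eq hω, h.stabProj_mul_errorOp hω ht]

/-- Error operators commuting with the stabilizer preserve the code. -/
theorem errorOp_commute_projector (hω : ω ^ 2 + ω + 1 = 0) (h : IsJointEigenspace ω S ε Q)
    {x : Fin n → F4} (hx : x ∈ hermitianDual S) :
    errorOp ω x * projector Q = projector Q * errorOp ω x := by
  classical
  rw [h.projector_eq hω, stabProj, Matrix.mul_smul, smul_mul_assoc, Finset.mul_sum, Finset.sum_mul]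
  congr 1
  refine Finset.sum_congr rfl fun s _ => ?_
  rw [Matrix.mul_smul, smul_mul_assoc, errorOp_mul_comm hω, hx s s.2, sgn_zero, one_smul]

/-- Error operators anticommuting with some element of the stabilizer map the code to an
orthogonal eigenspace. -/
theorem projector_mul_errorOp_mul_projector (hω : ω ^ 2 + ω + 1 = 0)
    (h : IsJointEigenspace ω S ε Q) {x : Fin n → F4} (hx : x ∉ hermitianDual S) :
    projector Q * errorOp ω x * projector Q = 0 := by
  obtain ⟨s, hs, hxs⟩ : ∃ s ∈ S, traceInner x s ≠ 0 := by
    by_contra! h'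
    exact hx h'
  have h1 : errorOp ω x * errorOp ω s = -(errorOp ω s * errorOp ω x) := by
    rw [errorOp_mul_comm hω, sgn, if_neg hxs, neg_smul, one_smul]
  have h2 : projector Q * (errorOp ω x * errorOp ω s) * projector Q =
      ε s • (projector Q * errorOp ω x * projector Q) := by
    rw [← mul_assoc, mul_assoc, h.errorOp_mul_projector hω hs, Matrix.mul_smul]
  have h3 : projector Q * (errorOp ω x * errorOp ω s) * projector Q =
      -(ε s • (projector Q * errorOp ω x * projector Q)) := by
    rw [h1, Matrix.mul_neg, ← mul_assoc, h.projector_mul_errorOp hω hs, Matrix.neg_mul,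
      smul_mul_assoc, smul_mul_assoc]
  have h4 := eq_neg_iff_add_eq_zero.1 (h2.symm.trans h3)
  rw [← two_smul ℂ, smul_eq_zero_iff_right two_ne_zero] at h4
  refine (smul_eq_zero.1 h4).resolve_left ?_
  intro h0
  simpa [h0] using h.eigenvalue_mul_self hs

/-! ### The quantum enumerators count words -/

open Classical in
theorem enumBperp_eq (hω : ω ^ 2 + ω + 1 = 0) (h : IsJointEigenspace ω S ε Q) (j : ℕ) :
    enumBperp ω Q j = ((Finset.univ.filter fun x : Fin n → F4 => hammingNorm x = j).filter
      fun x => x ∈ S).card := by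
  have hd := h.finrank_ne_zero
  rw [enumBperp, Finset.card_filter, Nat.cast_sum, Finset.mul_sum]
  refine Finset.sum_congr rfl fun x _ => ?_
  rw [h.trace_errorOp_mul_projector hω, ← h.finrank_eq hω]
  split_ifs with hx
  · have h1 : (ε x * (Module.finrank ℂ Q : ℂ)) ^ 2 = (((Module.finrank ℂ Q : ℝ) ^ 2 : ℝ) : ℂ) := by
      push_cast
      linear_combination (Module.finrank ℂ Q : ℂ) ^ 2 * h.eigenvalue_mul_self hx
    rw [h1, Complex.ofReal_re]
    field_simp
    simp
  · simp

open Classical in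
theorem enumB_eq (hω : ω ^ 2 + ω + 1 = 0) (h : IsJointEigenspace ω S ε Q) (j : ℕ) :
    enumB ω Q j = ((Finset.univ.filter fun x : Fin n → F4 => hammingNorm x = j).filter
      fun x => x ∈ hermitianDual S).card := by
  have hd := h.finrank_ne_zero
  rw [enumB, Finset.card_filter, Nat.cast_sum, Finset.mul_sum]
  refine Finset.sum_congr rfl fun x _ => ?_
  split_ifs with hx
  · rw [h.errorOp_commute_projector hω hx, mul_assoc (projector Q), errorOp_mul_self, mul_one,
      h.projector_mul_self hω, trace_projector]
    simp [hd]
  · rw [mul_assoc, mul_assoc, ← mul_assoc (projector Q), h.projector_mul_errorOp_mul_projector hω hx]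
    simp

end IsJointEigenspace

/-! ### Recovery operators -/

theorem expectation_eq_trace (A : Op n) (ψ : Qubits n) :
    expectation A ψ = (A * pureState ψ).trace.re := by
  rw [expectation, pureState, Matrix.mul_vecMulVec, Matrix.trace_vecMulVec, dotProduct_comm]

theorem conjTranspose_pureState (ψ : Qubits n) : (pureState ψ)ᴴ = pureState ψ := by
  rw [pureState, Matrix.conjTranspose_vecMulVec, star_star]

theorem trace_pureState {ψ : Qubits n} (hψ : ‖ψ‖ = 1) : (pureState ψ).trace = 1 := by
  have h := EuclideanSpace.inner_eq_star_dotProduct ψ ψ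
  rw [pureState, Matrix.trace_vecMulVec, ← h, inner_self_eq_norm_sq_to_K, hψ]
  simp

theorem pureState_mul_self {ψ : Qubits n} (hψ : ‖ψ‖ = 1) :
    pureState ψ * pureState ψ = pureState ψ := by
  have h := trace_pureState hψ
  rw [pureState, Matrix.trace_vecMulVec, dotProduct_comm] at h
  rw [pureState, Matrix.vecMulVec_mul_vecMulVec, h, one_smul]

theorem posSemidef_pureState (ψ : Qubits n) : (pureState ψ).PosSemidef :=
  Matrix.posSemidef_vecMulVec_self_star _

theorem mul_pureState_of_mulVec_eq {A : Op n} {c : ℂ} {ψ : Qubits n}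
    (h : A *ᵥ WithLp.ofLp ψ = c • WithLp.ofLp ψ) : A * pureState ψ = c • pureState ψ := by
  rw [pureState, Matrix.mul_vecMulVec, h, Matrix.smul_vecMulVec]

theorem expectation_nonneg {A : Op n} (hA : A.PosSemidef) (ψ : Qubits n) :
    0 ≤ expectation A ψ :=
  (Complex.le_def.1 (hA.dotProduct_mulVec_nonneg (WithLp.ofLp ψ))).1

/-- If `L` stands for an error followed by a correction, this is the squared overlap
`|⟨ψ|L|ψ⟩|²`. -/
theorem overlap_nonneg (L : Op n) (ψ : Qubits n) :
    0 ≤ (L * pureState ψ * Lᴴ * pureState ψ).trace.re := by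
  rw [← expectation_eq_trace]
  exact expectation_nonneg ((posSemidef_pureState ψ).mul_mul_conjTranspose_same L) ψ

/-- Compressing `A` to the orthogonal complement of `ψ` leaves a positive semidefinite operator,
of trace `Tr A - ⟨ψ|A|ψ⟩`. -/
theorem expectation_le_trace {A : Op n} (hA : A.PosSemidef) {ψ : Qubits n} (hψ : ‖ψ‖ = 1) :
    expectation A ψ ≤ A.trace.re := by
  have h1 := (hA.mul_mul_conjTranspose_same (1 - pureState ψ)).trace_nonneg
  have h2 : (1 - pureState ψ) * (1 - pureState ψ) = 1 - pureState ψ := by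
    rw [mul_sub, sub_mul, sub_mul, pureState_mul_self hψ]
    simp
  rw [Matrix.conjTranspose_sub, Matrix.conjTranspose_one, conjTranspose_pureState,
    Matrix.trace_mul_cycle, h2, sub_mul, one_mul, Matrix.trace_sub,
    Matrix.trace_mul_comm] at h1
  rw [expectation_eq_trace]
  have := (Complex.le_def.1 h1).1
  simpa using this

theorem IsCompletelyPositive.posSemidef {R : Op n →ₗ[ℂ] Op n} (hR : IsCompletelyPositive R)
    {A : Op n} (hA : A.PosSemidef) : (R A).PosSemidef := by
  have h := hR 1 (A.submatrix Prod.snd Prod.snd) (hA.submatrix Prod.snd)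
  exact h.submatrix fun a : Idx n => ((0 : Fin 1), a)

/-- The linear map `A ↦ c ∑ i, K i A (K i)ᴴ`. -/
def krausMap {ι : Type*} [Fintype ι] (c : ℂ) (K : ι → Op n) : Op n →ₗ[ℂ] Op n where
  toFun A := c • ∑ i, K i * A * (K i)ᴴ
  map_add' A B := by
    simp only [mul_add, add_mul, Finset.sum_add_distrib, smul_add]
  map_smul' a A := by
    simp only [Matrix.mul_smul, smul_mul_assoc, ← Finset.smul_sum, RingHom.id_apply]
    rw [smul_comm]

theorem krausMap_apply {ι : Type*} [Fintype ι] (c : ℂ) (K : ι → Op n) (A : Op n) :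
    krausMap c K A = c • ∑ i, K i * A * (K i)ᴴ := rfl

theorem isRecovery_krausMap {ι : Type*} [Fintype ι] {c : ℂ} (hc : 0 ≤ c) {K : ι → Op n}
    (hK : c • ∑ i, (K i)ᴴ * K i = 1) : IsRecovery (krausMap c K) where
  completelyPositive := by
    intro k A hA
    have h : (Matrix.of fun r s : Fin k × Idx n =>
        krausMap c K (Matrix.of fun a b => A (r.1, a) (s.1, b)) r.2 s.2) =
        c • ∑ i, Matrix.kroneckerMap (· * ·) (1 : Matrix (Fin k) (Fin k) ℂ) (K i) * A *
          (Matrix.kroneckerMap (· * ·) (1 : Matrix (Fin k) (Fin k) ℂ) (K i))ᴴ := by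
      ext r s
      simp only [krausMap_apply, Matrix.of_apply, Matrix.smul_apply, Matrix.sum_apply]
      congr 1
      refine Finset.sum_congr rfl fun i _ => ?_
      simp [Matrix.mul_apply, Fintype.sum_prod_type, Matrix.one_apply,
        Matrix.conjTranspose_apply, Finset.sum_ite_irrel, apply_ite]
    rw [h]
    refine Matrix.PosSemidef.smul (Matrix.posSemidef_sum _ fun i _ => ?_) hc
    exact hA.mul_mul_conjTranspose_same _
  tracePreserving := by
    intro ρ
    have h : (krausMap c K ρ).trace = ((c • ∑ i, (K i)ᴴ * K i) * ρ).trace := by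
      rw [krausMap_apply, smul_mul_assoc, Finset.sum_mul, Matrix.trace_smul, Matrix.trace_smul,
        Matrix.trace_sum, Matrix.trace_sum]
      congr 1
      exact Finset.sum_congr rfl fun i _ => Matrix.trace_mul_cycle _ _ _
    rw [h, hK, one_mul]

/-! ### The depolarizing channel -/

theorem errorProb_eq_prod (p : ℝ) (x : Fin n → F4) :
    errorProb p x = ∏ i, if x i = 0 then 1 - p else p / 3 := by
  have h : ({i | ¬ x i = 0} : Finset (Fin n)).card = hammingNorm x := rfl
  have h2 := Finset.card_filter_add_card_filter_not (s := (Finset.univ : Finset (Fin n)))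
    (fun i => x i = 0)
  rw [h, Finset.card_univ, Fintype.card_fin] at h2
  rw [Finset.prod_ite, Finset.prod_const, Finset.prod_const, h, errorProb, mul_comm]
  congr 2
  omega

theorem sum_errorProb (p : ℝ) : ∑ x : Fin n → F4, errorProb p x = 1 := by
  simp only [errorProb_eq_prod]
  rw [← Fintype.prod_sum (fun (_ : Fin n) (a : F4) => if a = 0 then 1 - p else p / 3)]
  refine Finset.prod_eq_one fun i _ => ?_
  have h : ({a : F4 | ¬ a = 0} : Finset F4).card = 3 := by
    have h2 := Finset.card_filter_add_card_filter_not (s := (Finset.univ : Finset F4))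
      (fun a => a = 0)
    rw [Finset.card_univ, F4.fintype_card, Finset.filter_eq' Finset.univ (0 : F4),
      if_pos (Finset.mem_univ _), Finset.card_singleton] at h2
    omega
  rw [Finset.sum_ite, Finset.sum_const, Finset.sum_const, h,
    Finset.filter_eq' Finset.univ (0 : F4), if_pos (Finset.mem_univ _), Finset.card_singleton]
  simp only [nsmul_eq_mul]
  push_cast
  ring

theorem errorProb_nonneg {p : ℝ} (hp0 : 0 ≤ p) (hp1 : p ≤ 1) (x : Fin n → F4) :
    0 ≤ errorProb p x :=
  mul_nonneg (pow_nonneg (by linarith) _) (pow_nonneg (by linarith) _)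

theorem posSemidef_depolarizing (ω : F4) {p : ℝ} (hp0 : 0 ≤ p) (hp1 : p ≤ 1) {ρ : Op n}
    (hρ : ρ.PosSemidef) : (depolarizing ω p ρ).PosSemidef :=
  Matrix.posSemidef_sum _ fun x _ => Matrix.PosSemidef.smul (hρ.mul_mul_conjTranspose_same _)
    (Complex.zero_le_real.2 (errorProb_nonneg hp0 hp1 x))

theorem trace_depolarizing (ω : F4) (p : ℝ) (ρ : Op n) :
    (depolarizing ω p ρ).trace = ρ.trace := by
  have h : ∀ x : Fin n → F4, (errorOp ω x * ρ * (errorOp ω x)ᴴ).trace = ρ.trace := fun x => by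
    rw [Matrix.trace_mul_cycle, conjTranspose_errorOp, errorOp_mul_self, one_mul]
  simp only [depolarizing, Matrix.trace_sum, Matrix.trace_smul, h]
  rw [← Finset.sum_smul, ← Complex.ofReal_sum, sum_errorProb, Complex.ofReal_one, one_smul]

theorem exists_unit_vec {Q : Submodule ℂ (Qubits n)} (hQ : Q ≠ ⊥) : ∃ ψ ∈ Q, ‖ψ‖ = 1 := by
  obtain ⟨ψ, hψ, hne⟩ := Submodule.exists_mem_ne_zero_of_ne_bot hQ
  exact ⟨((‖ψ‖ : ℂ)⁻¹) • ψ, Q.smul_mem _ hψ, norm_smul_inv_norm hne⟩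

theorem minFidelity_le_one (ω : F4) {p : ℝ} (hp0 : 0 ≤ p) (hp1 : p ≤ 1)
    {Q : Submodule ℂ (Qubits n)} (hQ : Q ≠ ⊥) {R : Op n →ₗ[ℂ] Op n} (hR : IsRecovery R) :
    minFidelity ω p Q R ≤ 1 := by
  obtain ⟨ψ, hψ, hn⟩ := exists_unit_vec hQ
  have hpos : ∀ φ : Qubits n, (R (depolarizing ω p (pureState φ))).PosSemidef := fun φ =>
    hR.completelyPositive.posSemidef (posSemidef_depolarizing ω hp0 hp1 (posSemidef_pureState φ))
  refine (ciInf_le ⟨0, ?_⟩ (⟨ψ, hψ, hn⟩ : {ψ : Qubits n // ψ ∈ Q ∧ ‖ψ‖ = 1})).trans ?_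
  · rintro _ ⟨φ, rfl⟩
    exact expectation_nonneg (hpos _) _
  · refine (expectation_le_trace (hpos _) hn).trans ?_
    rw [hR.tracePreserving, trace_depolarizing, trace_pureState hn, Complex.one_re]

theorem le_fidelity (ω : F4) {p : ℝ} (hp0 : 0 ≤ p) (hp1 : p ≤ 1)
    {Q : Submodule ℂ (Qubits n)} (hQ : Q ≠ ⊥) {R : Op n →ₗ[ℂ] Op n} (hR : IsRecovery R)
    {v : ℝ} (hv : ∀ ψ ∈ Q, ‖ψ‖ = 1 →
      v ≤ expectation (R (depolarizing ω p (pureState ψ))) ψ) : v ≤ fidelity ω p Q := by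
  refine le_ciSup_of_le ⟨1, ?_⟩ (⟨R, hR⟩ : {R : Op n →ₗ[ℂ] Op n // IsRecovery R}) ?_
  · rintro _ ⟨R, rfl⟩
    exact minFidelity_le_one ω hp0 hp1 hQ R.2
  · obtain ⟨ψ, hψ, hn⟩ := exists_unit_vec hQ
    have : Nonempty {ψ : Qubits n // ψ ∈ Q ∧ ‖ψ‖ = 1} := ⟨⟨ψ, hψ, hn⟩⟩
    exact le_ciInf fun φ => hv φ.1 φ.2.1 φ.2.2

/-! ### Decoding by coset representatives -/

theorem neg_eq_self_of_F4 (x : Fin n → F4) : -x = x := by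
  rw [neg_eq_iff_add_eq_zero, add_eq_zero_iff_eq_of_F4]

namespace IsJointEigenspace

variable {ω : F4} {S : AddSubgroup (Fin n → F4)} {ε : (Fin n → F4) → ℂ}
  {Q : Submodule ℂ (Qubits n)}

theorem errorOp_conj_projector_congr (hω : ω ^ 2 + ω + 1 = 0) (h : IsJointEigenspace ω S ε Q)
    {x y : Fin n → F4} (hxy : x - y ∈ hermitianDual S) :
    errorOp ω y * projector Q * errorOp ω y = errorOp ω x * projector Q * errorOp ω x := by
  obtain ⟨φ, hφ, hE⟩ := exists_errorOp_mul hω x (x - y)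
  have hy : x + (x - y) = y := by
    rw [← neg_eq_self_of_F4 (x - y)]
    abel
  rw [hy] at hE
  have h1 : φ • errorOp ω y * projector Q * (φ • errorOp ω y)ᴴ =
      errorOp ω x * projector Q * errorOp ω x := by
    rw [← hE, Matrix.conjTranspose_mul, conjTranspose_errorOp, conjTranspose_errorOp,
      mul_assoc (errorOp ω x), h.errorOp_commute_projector hω hxy]
    simp only [mul_assoc, errorOp_mul_cancel]
  rw [← h1, Matrix.conjTranspose_smul, conjTranspose_errorOp, Matrix.mul_smul, smul_mul_assoc,
    smul_mul_assoc, smul_smul, hφ, one_smul]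

/-- The projectors onto the translates `E_y Q` add up to the identity, each translate being
counted once for every element of the dual of the stabilizer. -/
theorem sum_errorOp_conj_projector (hω : ω ^ 2 + ω + 1 = 0) (h : IsJointEigenspace ω S ε Q) :
    ∑ y : Fin n → F4, errorOp ω y * projector Q * errorOp ω y =
      (Nat.card (hermitianDual S) : ℂ) • (1 : Op n) := by
  classical
  obtain ⟨C, hC⟩ : ∃ C : ℂ, ∑ y : Fin n → F4, errorOp ω y * projector Q * errorOp ω y =
      C • (1 : Op n) := by
    refine ⟨(Nat.card S : ℂ)⁻¹ * Fintype.card (Fin n → F4), ?_⟩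
    have h1 : ∀ y : Fin n → F4, errorOp ω y * projector Q * errorOp ω y =
        (Nat.card S : ℂ)⁻¹ • ∑ s : S, ε s • (errorOp ω y * errorOp ω s * errorOp ω y) := by
      intro y
      rw [h.projector_eq hω, stabProj, Matrix.mul_smul, smul_mul_assoc, Finset.mul_sum,
        Finset.sum_mul]
      simp only [Matrix.mul_smul, smul_mul_assoc]
    simp only [h1]
    rw [← Finset.smul_sum, Finset.sum_comm, mul_smul]
    congr 1
    simp only [← Finset.smul_sum]
    rw [Finset.sum_eq_single (0 : S)]
    · simp only [ZeroMemClass.coe_zero, h.eigenvalue_zero, errorOp_zero, mul_one, errorOp_mul_self,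
        Finset.sum_const, one_smul, Finset.card_univ, Nat.cast_smul_eq_nsmul]
    · intro s _ hs
      rw [sum_errorOp_conj hω (fun e => hs (Subtype.ext e)), smul_zero]
    · simp
  -- The scalar is found by multiplying by the projector.
  have h2 : C • projector Q = (Nat.card (hermitianDual S) : ℂ) • projector Q := by
    calc C • projector Q
        = projector Q * ∑ y : Fin n → F4, errorOp ω y * projector Q * errorOp ω y := by
          rw [hC, Matrix.mul_smul, mul_one]
      _ = ∑ y : Fin n → F4, if y ∈ hermitianDual S then projector Q else 0 := by
          rw [Finset.mul_sum]
          refine Finset.sum_congr rfl fun y _ => ?_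
          split_ifs with hy
          · rw [h.errorOp_commute_projector hω hy, mul_assoc, errorOp_mul_self, mul_one,
              h.projector_mul_self hω]
          · rw [← mul_assoc, ← mul_assoc, h.projector_mul_errorOp_mul_projector hω hy, zero_mul]
      _ = _ := by
          rw [← Finset.sum_filter, Finset.sum_const, Nat.cast_smul_eq_nsmul,
            Nat.card_eq_fintype_card, Fintype.card_subtype]
  rw [hC, smul_left_injective ℂ h.projector_ne_zero h2]

theorem overlap_eq_one (hω : ω ^ 2 + ω + 1 = 0) (h : IsJointEigenspace ω S ε Q)
    {x y : Fin n → F4} (hxy : x - y ∈ S) {ψ : Qubits n} (hψ : ψ ∈ Q) (hn : ‖ψ‖ = 1) :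
    ((errorOp ω y * errorOp ω x) * pureState ψ * (errorOp ω y * errorOp ω x)ᴴ *
      pureState ψ).trace.re = 1 := by
  obtain ⟨φ, hφ, hE⟩ := exists_errorOp_mul hω y x
  have hyx : y + x = x - y := by
    rw [sub_eq_neg_add, neg_eq_self_of_F4]
  have h1 : errorOp ω y * errorOp ω x * pureState ψ = (φ * ε (x - y)) • pureState ψ := by
    rw [hE, hyx, smul_mul_assoc,
      mul_pureState_of_mulVec_eq ((h.mem_iff ψ).1 hψ _ hxy), smul_smul]
  have h2 : pureState ψ * (errorOp ω y * errorOp ω x)ᴴ = star (φ * ε (x - y)) • pureState ψ := by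
    have := congrArg Matrix.conjTranspose h1
    rwa [Matrix.conjTranspose_mul, Matrix.conjTranspose_smul, conjTranspose_pureState] at this
  have h3 : star (φ * ε (x - y)) * (φ * ε (x - y)) = 1 := by
    rw [star_mul, h.star_eigenvalue hxy]
    linear_combination ε (x - y) * ε (x - y) * hφ + h.eigenvalue_mul_self hxy
  rw [h1, smul_mul_assoc, h2, smul_smul, smul_mul_assoc, pureState_mul_self hn, mul_comm, h3,
    one_smul, trace_pureState hn, Complex.one_re]

open Classical in
/-- Correcting with the representative `r` of the coset of an error modulo the dual of the
stabilizer recovers the state from every error which differs from its representative by an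
element of the stabilizer. -/
theorem sum_errorProb_le_fidelity (hω : ω ^ 2 + ω + 1 = 0) (h : IsJointEigenspace ω S ε Q)
    {p : ℝ} (hp0 : 0 ≤ p) (hp1 : p ≤ 1) (r : (Fin n → F4) → (Fin n → F4))
    (hr : ∀ x, x - r x ∈ hermitianDual S)
    (hr' : ∀ x y, x - y ∈ hermitianDual S → r x = r y) :
    ∑ x : Fin n → F4 with x - r x ∈ S, errorProb p x ≤ fidelity ω p Q := by
  set c : ℝ := (Nat.card (hermitianDual S) : ℝ)⁻¹ with hc
  have hc0 : 0 ≤ c := by positivity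
  have hcard : (Nat.card (hermitianDual S) : ℝ) ≠ 0 := Nat.cast_ne_zero.2 Nat.card_pos.ne'
  set K : (Fin n → F4) → Op n := fun y => projector Q * errorOp ω (r y) with hK
  have hKH : ∀ y, (K y)ᴴ = errorOp ω (r y) * projector Q := fun y => by
    rw [hK, Matrix.conjTranspose_mul, conjTranspose_errorOp, h.conjTranspose_projector hω]
  have hR : IsRecovery (krausMap (c : ℂ) K) := by
    refine isRecovery_krausMap (Complex.zero_le_real.2 hc0) ?_
    have h1 : ∀ y, (K y)ᴴ * K y = errorOp ω y * projector Q * errorOp ω y := fun y => by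
      rw [hKH, ← h.errorOp_conj_projector_congr hω (hr y), hK]
      simp only [mul_assoc]
      rw [← mul_assoc (projector Q), h.projector_mul_self hω]
    simp only [h1, h.sum_errorOp_conj_projector hω]
    rw [hc, Complex.ofReal_inv, Complex.ofReal_natCast, inv_smul_smul₀ (card_ne_zero _)]
  refine le_fidelity ω hp0 hp1 h.ne_bot hR fun ψ hψ hn => ?_
  set f : (Fin n → F4) → (Fin n → F4) → ℝ := fun y x =>
    ((errorOp ω (r y) * errorOp ω x) * pureState ψ * (errorOp ω (r y) * errorOp ω x)ᴴ *
      pureState ψ).trace.re with hf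
  have hexp : expectation (krausMap (c : ℂ) K (depolarizing ω p (pureState ψ))) ψ =
      c * ∑ y, ∑ x, errorProb p x * f y x := by
    have hl : projector Q * pureState ψ = pureState ψ := by
      rw [mul_pureState_of_mulVec_eq (c := 1) (by rw [one_smul, projector_mulVec hψ]), one_smul]
    have hterm : ∀ y x, (K y * (errorOp ω x * pureState ψ * (errorOp ω x)ᴴ) * (K y)ᴴ *
        pureState ψ).trace.re = f y x := by
      intro y x
      have hl' : pureState ψ * projector Q = pureState ψ := by
        have := congrArg Matrix.conjTranspose hl
        rwa [Matrix.conjTranspose_mul, conjTranspose_pureState,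
          h.conjTranspose_projector hω] at this
      have e : K y * (errorOp ω x * pureState ψ * (errorOp ω x)ᴴ) * (K y)ᴴ * pureState ψ =
          projector Q * ((errorOp ω (r y) * errorOp ω x) * pureState ψ *
            (errorOp ω (r y) * errorOp ω x)ᴴ * pureState ψ) := by
        rw [hKH]
        simp only [hK, Matrix.conjTranspose_mul, conjTranspose_errorOp, mul_assoc, hl]
      rw [e, Matrix.trace_mul_comm, mul_assoc _ (pureState ψ), hl']
    rw [expectation_eq_trace, krausMap_apply, smul_mul_assoc, Matrix.trace_smul, smul_eq_mul,
      Complex.re_ofReal_mul, Finset.sum_mul, Matrix.trace_sum, Complex.re_sum]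
    congr 1
    refine Finset.sum_congr rfl fun y _ => ?_
    rw [depolarizing, Finset.mul_sum, Finset.sum_mul, Finset.sum_mul, Matrix.trace_sum,
      Complex.re_sum]
    refine Finset.sum_congr rfl fun x _ => ?_
    rw [Matrix.mul_smul, smul_mul_assoc, smul_mul_assoc, Matrix.trace_smul, smul_eq_mul,
      Complex.re_ofReal_mul, hterm]
  have hcount : ∀ x : Fin n → F4,
      ∑ y : Fin n → F4, (if y - x ∈ hermitianDual S then (1 : ℝ) else 0) =
        Nat.card (hermitianDual S) := by
    intro x
    rw [← Equiv.sum_comp (Equiv.addRight x)]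
    simp only [Equiv.coe_addRight, add_sub_cancel_right]
    rw [Finset.sum_boole, Nat.card_eq_fintype_card, Fintype.card_subtype]
  rw [hexp, Finset.sum_comm, Finset.mul_sum, Finset.sum_filter]
  refine Finset.sum_le_sum fun x _ => ?_
  have hnn : ∀ y, 0 ≤ errorProb p x * f y x := fun y =>
    mul_nonneg (errorProb_nonneg hp0 hp1 x) (overlap_nonneg _ ψ)
  split_ifs with hx
  · calc errorProb p x
        = c * ∑ y : Fin n → F4, errorProb p x *
            (if y - x ∈ hermitianDual S then (1 : ℝ) else 0) := by
          rw [← Finset.mul_sum, hcount, hc]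
          field_simp
      _ ≤ _ := by
          refine mul_le_mul_of_nonneg_left (Finset.sum_le_sum fun y _ => ?_) hc0
          split_ifs with hy
          · have : f y x = 1 := by
              simp only [hf, hr' y x hy]
              exact h.overlap_eq_one hω hx hψ hn
            rw [this]
          · rw [mul_zero]
            exact hnn y
  · exact mul_nonneg hc0 (Finset.sum_nonneg fun y _ => hnn y)

end IsJointEigenspace

/-! ### Counting words by weight and distance -/

theorem card_compl_zero : ({0}ᶜ : Finset F4).card = 3 := by
  rw [Finset.card_compl, F4.fintype_card, Finset.card_singleton]

theorem card_compl_pair {a : F4} (ha : a ≠ 0) : ({0, a}ᶜ : Finset F4).card = 2 := by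
  rw [Finset.card_compl, F4.fintype_card, Finset.card_pair ha.symm]

theorem prod_ite_mem_const (s : Finset (Fin n)) (k : ℕ) :
    (∏ i, if i ∈ s then k else 1) = k ^ s.card := by
  rw [Finset.prod_ite_mem, Finset.univ_inter, Finset.prod_const]

theorem card_hammingNorm_eq_le (m : ℕ) :
    ({x | hammingNorm x = m} : Finset (Fin n → F4)).card ≤ n.choose m * 3 ^ m := by
  have hsub : ({x | hammingNorm x = m} : Finset (Fin n → F4)) ⊆
      (Finset.powersetCard m (Finset.univ : Finset (Fin n))).biUnion fun U =>
        Fintype.piFinset fun i => if i ∈ U then ({0}ᶜ : Finset F4) else {0} := by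
    intro x hx
    rw [Finset.mem_filter] at hx
    simp only [Finset.mem_biUnion, Finset.mem_powersetCard, Fintype.mem_piFinset]
    refine ⟨({i | x i ≠ 0} : Finset (Fin n)), ⟨Finset.subset_univ _, hx.2⟩, fun i => ?_⟩
    by_cases h : x i = 0 <;> simp [h]
  refine (Finset.card_le_card hsub).trans (Finset.card_biUnion_le.trans ?_)
  rw [Finset.sum_congr rfl (g := fun _ => 3 ^ m)]
  · rw [Finset.sum_const, Finset.card_powersetCard, Finset.card_univ, Fintype.card_fin,
      smul_eq_mul]
  · intro U hU
    rw [Fintype.card_piFinset, ← (Finset.mem_powersetCard.1 hU).2, ← prod_ite_mem_const]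
    refine Finset.prod_congr rfl fun i _ => ?_
    split_ifs
    · exact card_compl_zero
    · exact Finset.card_singleton _

/-- The words which, compared with `c`, are nonzero and different from `c` on `A`, equal to `c`
on `H`, nonzero on `U`, and zero elsewhere. -/
def patternBox (c : Fin n → F4) (A H U : Finset (Fin n)) : Finset (Fin n → F4) :=
  Fintype.piFinset fun i =>
    if i ∈ A then ({0, c i}ᶜ : Finset F4) else if i ∈ H then {c i}
      else if i ∈ U then {0}ᶜ else {0}

theorem card_patternBox_le (c : Fin n → F4) {A : Finset (Fin n)} (hA : ∀ i ∈ A, c i ≠ 0)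
    (H U : Finset (Fin n)) : (patternBox c A H U).card ≤ 2 ^ A.card * 3 ^ U.card := by
  rw [patternBox, Fintype.card_piFinset, ← prod_ite_mem_const, ← prod_ite_mem_const,
    ← Finset.prod_mul_distrib]
  refine Finset.prod_le_prod' fun i _ => ?_
  by_cases h1 : i ∈ A
  · rw [if_pos h1, if_pos h1, card_compl_pair (hA i h1)]
    split_ifs <;> norm_num
  · rw [if_neg h1, if_neg h1, one_mul]
    by_cases h2 : i ∈ H
    · rw [if_pos h2, Finset.card_singleton]
      split_ifs <;> norm_num
    · rw [if_neg h2]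
      split_ifs
      · exact card_compl_zero.le
      · exact (Finset.card_singleton _).le

/-- `G n m w` bounds the number of words of weight `m` at distance at most `m` from a given word
`c` of weight `w`. In the sum defining `G`, such a word is nonzero and different from `c` at `t`
places of the support of `c`, and equal to `c` at `h` others. -/
theorem card_le_G (m : ℕ) (c : Fin n → F4) :
    ({x | hammingNorm x = m ∧ hammingNorm (x - c) ≤ m} : Finset (Fin n → F4)).card ≤
      G n m (hammingNorm c) := by
  classical
  set w := hammingNorm c with hw
  set W : Finset (Fin n) := {i | c i ≠ 0} with hW
  have hWw : W.card = w := rfl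
  have hsub : ({x | hammingNorm x = m ∧ hammingNorm (x - c) ≤ m} : Finset (Fin n → F4)) ⊆
      (Finset.range (m + 1)).biUnion fun t => (Finset.powersetCard t W).biUnion fun A =>
        (Finset.Icc ((w - t + 1) / 2) (m - t)).biUnion fun h =>
          (Finset.powersetCard h (W \ A)).biUnion fun H =>
            (Finset.powersetCard (m - t - h) Wᶜ).biUnion fun U => patternBox c A H U := by
    intro x hx
    rw [Finset.mem_filter] at hx
    obtain ⟨-, hx1, hx2⟩ := hx
    set A : Finset (Fin n) := {i | c i ≠ 0 ∧ x i ≠ 0 ∧ x i ≠ c i} with hA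
    set H : Finset (Fin n) := {i | c i ≠ 0 ∧ x i = c i} with hH
    set U : Finset (Fin n) := {i | c i = 0 ∧ x i ≠ 0} with hU
    have hAW : A ⊆ W := fun i hi => by simp_all
    have hHW : H ⊆ W \ A := fun i hi => by simp_all
    have hUW : U ⊆ Wᶜ := fun i hi => by simp_all
    have hsupp : hammingNorm x = A.card + H.card + U.card := by
      simp only [hammingNorm, hA, hH, hU, Finset.card_filter, ← Finset.sum_add_distrib]
      refine Finset.sum_congr rfl fun i _ => ?_
      by_cases h1 : c i = 0 <;> by_cases h2 : x i = 0 <;> by_cases h3 : x i = c i <;>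
        simp_all
    have hdist : hammingNorm (x - c) + H.card = w + U.card := by
      simp only [hw, hammingNorm, hH, hU, Finset.card_filter, ← Finset.sum_add_distrib,
        Pi.sub_apply, sub_ne_zero]
      refine Finset.sum_congr rfl fun i _ => ?_
      by_cases h1 : c i = 0 <;> by_cases h2 : x i = 0 <;> by_cases h3 : x i = c i <;>
        simp_all
    simp only [Finset.mem_biUnion, Finset.mem_powersetCard, Finset.mem_range, Finset.mem_Icc]
    refine ⟨A.card, by omega, A, ⟨hAW, rfl⟩, H.card, ⟨by omega, by omega⟩, H, ⟨hHW, rfl⟩, U,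
      ⟨hUW, by omega⟩, ?_⟩
    rw [patternBox, Fintype.mem_piFinset]
    intro i
    by_cases h1 : c i = 0 <;> by_cases h2 : x i = 0 <;> by_cases h3 : x i = c i <;>
      simp_all
  refine (Finset.card_le_card hsub).trans (Finset.card_biUnion_le.trans ?_)
  refine Finset.sum_le_sum fun t _ => Finset.card_biUnion_le.trans ?_
  rw [mul_assoc, ← hWw, ← Finset.card_powersetCard, ← smul_eq_mul, ← Finset.sum_const]
  refine Finset.sum_le_sum fun A hA => Finset.card_biUnion_le.trans ?_
  obtain ⟨hAW, hAt⟩ := Finset.mem_powersetCard.1 hA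
  rw [Finset.mul_sum]
  refine Finset.sum_le_sum fun h _ => Finset.card_biUnion_le.trans ?_
  have e1 : (Finset.powersetCard h (W \ A)).card = (W.card - t).choose h := by
    rw [Finset.card_powersetCard, Finset.card_sdiff_of_subset hAW, hAt]
  have e2 : (Finset.powersetCard (m - t - h) Wᶜ).card = (n - W.card).choose (m - t - h) := by
    rw [Finset.card_powersetCard, Finset.card_compl, Fintype.card_fin]
  calc ∑ H ∈ Finset.powersetCard h (W \ A),
        ((Finset.powersetCard (m - t - h) Wᶜ).biUnion fun U => patternBox c A H U).card
      ≤ ∑ H ∈ Finset.powersetCard h (W \ A), ∑ U ∈ Finset.powersetCard (m - t - h) Wᶜ,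
          2 ^ t * 3 ^ (m - t - h) := by
        refine Finset.sum_le_sum fun H _ => Finset.card_biUnion_le.trans ?_
        refine Finset.sum_le_sum fun U hU => ?_
        have hc : ∀ i ∈ A, c i ≠ 0 := fun i hi => (Finset.mem_filter.1 (hAW hi)).2
        have := card_patternBox_le c hc H U
        rwa [hAt, (Finset.mem_powersetCard.1 hU).2] at this
    _ = _ := by
        rw [Finset.sum_const, Finset.sum_const, e1, e2, smul_eq_mul, smul_eq_mul]
        ring

/-! ### Uncorrected errors -/

/-- Every coset of an additive code has a representative of least weight. -/
theorem exists_minWeight_representative (T : AddSubgroup (Fin n → F4)) :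
    ∃ r : (Fin n → F4) → (Fin n → F4), (∀ x, x - r x ∈ T) ∧
      (∀ x y, x - y ∈ T → r x = r y) ∧ ∀ x, hammingNorm (r x) ≤ hammingNorm x := by
  have h : ∀ q : (Fin n → F4) ⧸ T, ∃ y : Fin n → F4, (y : (Fin n → F4) ⧸ T) = q ∧
      ∀ z : Fin n → F4, (z : (Fin n → F4) ⧸ T) = q → hammingNorm y ≤ hammingNorm z := by
    intro q
    obtain ⟨x, hx⟩ := QuotientAddGroup.mk_surjective q
    obtain ⟨y, hy, hmin⟩ := Set.exists_min_image {z : Fin n → F4 | (z : (Fin n → F4) ⧸ T) = q}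
      (fun z => hammingNorm z) (Set.toFinite _) ⟨x, hx⟩
    exact ⟨y, hy, hmin⟩
  choose g hg hmin using h
  refine ⟨fun x => g x, fun x => ?_, fun x y hxy => ?_, fun x => hmin _ _ rfl⟩
  · rw [sub_eq_neg_add]
    exact QuotientAddGroup.eq.1 (hg x)
  · have h1 : (y : (Fin n → F4) ⧸ T) = x := by
      rw [QuotientAddGroup.eq, neg_add_eq_sub]
      exact hxy
    simp only [h1]

open Classical in
/-- An uncorrected error `x` of weight `m` is within distance `m` of the word `x - r x`, which lies
in the dual of the stabilizer but not in the stabilizer; summing over these words bounds the number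
of such errors by `N(m)`. -/
theorem IsJointEigenspace.card_uncorrected_le {ω : F4} (hω : ω ^ 2 + ω + 1 = 0)
    {S : AddSubgroup (Fin n → F4)} {ε : (Fin n → F4) → ℂ} {Q : Submodule ℂ (Qubits n)}
    (h : IsJointEigenspace ω S ε Q) (hS : S ≤ hermitianDual S)
    {r : (Fin n → F4) → (Fin n → F4)} (hr : ∀ x, x - r x ∈ hermitianDual S)
    (hmin : ∀ x, hammingNorm (r x) ≤ hammingNorm x) (m : ℕ) :
    ((({x | hammingNorm x = m ∧ x - r x ∉ S} : Finset (Fin n → F4)).card : ℕ) : ℝ) ≤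
      N ω Q m := by
  set D : ℕ → Finset (Fin n → F4) := fun w =>
    ({c | hammingNorm c = w} : Finset (Fin n → F4)).filter fun c => c ∈ hermitianDual S ∧ c ∉ S
  have hD : ∀ w, ((D w).card : ℝ) = enumB ω Q w - enumBperp ω Q w := by
    intro w
    rw [h.enumB_eq hω, h.enumBperp_eq hω, eq_sub_iff_add_eq, ← Nat.cast_add, Nat.cast_inj,
      ← Finset.card_union_of_disjoint]
    · congr 1
      ext c
      have := @hS c
      simp only [D, Finset.mem_union, Finset.mem_filter, Finset.mem_univ, true_and]
      tauto
    · rw [Finset.disjoint_left]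
      intro c hc hc'
      exact (Finset.mem_filter.1 hc).2.2 (Finset.mem_filter.1 hc').2
  have hsub : ({x | hammingNorm x = m ∧ x - r x ∉ S} : Finset (Fin n → F4)) ⊆
      (Finset.Icc 1 (min (2 * m) n)).biUnion fun w => (D w).biUnion fun c =>
        ({x | hammingNorm x = m ∧ hammingNorm (x - c) ≤ m} : Finset (Fin n → F4)) := by
    intro x hx
    simp only [Finset.mem_filter, Finset.mem_univ, true_and] at hx
    have hrm : hammingNorm (r x) ≤ m := hx.1 ▸ hmin x
    have h1 : hammingNorm (x - r x) ≤ 2 * m := by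
      rw [sub_eq_neg_add, ← hammingDist_eq_hammingNorm]
      have := hammingDist_triangle (r x) 0 x
      rw [hammingDist_zero_right, hammingDist_zero_left] at this
      omega
    have h2 : hammingNorm (x - r x) ≤ n := by
      simpa using hammingNorm_le_card_fintype (x := x - r x)
    have h3 : 0 < hammingNorm (x - r x) := by
      rw [hammingNorm_pos_iff]
      intro h0
      exact hx.2 (h0 ▸ S.zero_mem)
    simp only [D, Finset.mem_biUnion, Finset.mem_filter, Finset.mem_univ, true_and,
      Finset.mem_Icc]
    exact ⟨hammingNorm (x - r x), ⟨h3, le_min h1 h2⟩, x - r x, ⟨rfl, hr x, hx.2⟩, hx.1,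
      by rwa [sub_sub_cancel]⟩
  have hcard := (Finset.card_le_card hsub).trans (Finset.card_biUnion_le.trans
    (Finset.sum_le_sum fun w _ => (Finset.card_biUnion_le.trans
      (Finset.sum_le_card_nsmul (D w) _ (G n m w) fun c hc => by
        have hw : hammingNorm c = w := (Finset.mem_filter.1 (Finset.mem_filter.1 hc).1).2
        exact hw ▸ card_le_G m c))))
  refine (Nat.cast_le.2 hcard).trans (le_of_eq ?_)
  rw [N, Nat.cast_sum]
  exact Finset.sum_congr rfl fun w _ => by rw [smul_eq_mul, Nat.cast_mul, hD]

end QCode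
end

theorem theorem1 (ω : QCode.F4) (hω : ω ^ 2 + ω + 1 = 0) (n : ℕ) (p : ℝ) (hp0 : 0 ≤ p)
    (hp1 : p ≤ 1) (Q : Submodule ℂ (QCode.Qubits n)) (hQ : QCode.IsStabilizerCode ω Q) :
    1 - QCode.fidelity ω p Q ≤
      ∑ m ∈ Finset.Icc 1 n, (p / 3) ^ m * (1 - p) ^ (n - m) *
        min ((n.choose m : ℝ) * 3 ^ m) (QCode.N ω Q m) := by
  classical
  obtain ⟨C, hC, hne, ε, hmem⟩ := hQ
  set S := QCode.hermitianDual C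
  have h : QCode.IsJointEigenspace ω S ε Q := ⟨hne, hmem⟩
  have hS : S ≤ QCode.hermitianDual S := fun s hs t ht => by
    rw [QCode.traceInner_comm]
    exact ht s (hC hs)
  obtain ⟨r, hr, hr', hmin⟩ := QCode.exists_minWeight_representative (QCode.hermitianDual S)
  have hF := h.sum_errorProb_le_fidelity hω hp0 hp1 r hr hr'
  have hsplit := Finset.sum_filter_add_sum_filter_not Finset.univ
    (fun x : Fin n → QCode.F4 => x - r x ∈ S) (QCode.errorProb p)
  rw [QCode.sum_errorProb] at hsplit
  have hmaps : ∀ x ∈ ({x | x - r x ∉ S} : Finset (Fin n → QCode.F4)),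
      hammingNorm x ∈ Finset.Icc 1 n := by
    intro x hx
    rw [Finset.mem_Icc]
    refine ⟨?_, by simpa using hammingNorm_le_card_fintype (x := x)⟩
    -- The zero word is its own representative, so every uncorrected word has positive weight.
    by_contra! h0
    rw [hammingNorm_lt_one] at h0
    have hr0 : r 0 = 0 := by
      have := hmin 0
      rwa [hammingNorm_zero, Nat.le_zero, hammingNorm_eq_zero] at this
    refine (Finset.mem_filter.1 hx).2 ?_
    rw [h0, hr0, sub_zero]
    exact S.zero_mem
  rw [← Finset.sum_fiberwise_of_maps_to hmaps] at hsplit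
  have hbound : ∀ m ∈ Finset.Icc 1 n,
      ∑ x ∈ ({x | x - r x ∉ S} : Finset (Fin n → QCode.F4)) with hammingNorm x = m,
        QCode.errorProb p x ≤ (p / 3) ^ m * (1 - p) ^ (n - m) *
          min ((n.choose m : ℝ) * 3 ^ m) (QCode.N ω Q m) := by
    intro m _
    have hset : ({x ∈ ({x | x - r x ∉ S} : Finset (Fin n → QCode.F4)) | hammingNorm x = m}) =
        ({x | hammingNorm x = m ∧ x - r x ∉ S} : Finset (Fin n → QCode.F4)) := by
      rw [Finset.filter_filter]
      simp only [and_comm]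
    rw [hset, Finset.sum_congr rfl (g := fun _ => (p / 3) ^ m * (1 - p) ^ (n - m)),
      Finset.sum_const, nsmul_eq_mul, mul_comm]
    · refine mul_le_mul_of_nonneg_left (le_min ?_ (h.card_uncorrected_le hω hS hr hmin m))
        (mul_nonneg (pow_nonneg (by linarith) _) (pow_nonneg (by linarith) _))
      have h1 : ({x | hammingNorm x = m ∧ x - r x ∉ S} : Finset (Fin n → QCode.F4)).card ≤
          n.choose m * 3 ^ m :=
        (Finset.card_le_card fun x hx => by
          simp only [Finset.mem_filter] at hx ⊢
          exact ⟨hx.1, hx.2.1⟩).trans (QCode.card_hammingNorm_eq_le m)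
      exact_mod_cast h1
    · intro x hx
      rw [QCode.errorProb, (Finset.mem_filter.1 hx).2.1]
  have := Finset.sum_le_sum hbound
  linarith
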